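/- Let $E$ be a (real) Banach lattice with topological dual $E'$ and positive cones $E^+$, $(E')^+$. For $\mathcal S\subset E$ let $sol(\mathcal S)=\{x\in E:\exists y\in \mathcal S,\ |x|\le |y|\}$. A norm bounded set $\mathcal S\subset E$ is called L-weakly compact if $\|x_n\|\to 0$ for every disjoint sequence $(x_n)$ in $sol(\mathcal S)$. A net $(x_\alpha)$ in $E$ is uaw-convergent to $x\in E$, written $x_\alpha\overset{uaw}\longrightarrow x$, if $|x_\alpha-x|\wedge u\to 0$ weakly for every $u\in E^+$. A set $A\subset E$ is uaw-compact (resp. relatively uaw-compact) if every net in $A$ has a subnet that is uaw-convergent to a point of $A$ (resp. to a point of $E$). For a norm bounded subset $\mathcal S$ of $E$, the following statements are equivalent: 1. $\mathcal S$ is L-weakly compact. 2. For each $\varepsilon>0$ there exist $g\in (E')^+$ and $u\in E^+$ such that $\|x\|\le g(|x|\wedge u)+\varepsilon$ for every $x\in sol(\mathcal S)$. 3. For every net $(x_\alpha)\subset sol(\mathcal S)$ such that $x_\alpha\overset{uaw}\longrightarrow 0$, we have $\|x_\alpha\|\to 0$. 4. Every norm bounded uaw-compact subset $A\subset sol(\mathcal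 S)$ is norm compact. 5. Every norm bounded relatively uaw-compact subset $A\subset sol(\mathcal S)$ is relatively norm compact. -/

import Mathlib

open Filter Topology

universe u v

/-- `UawTendsto l x a`: the family `x` converges to `a` along the filter `l` in the unbounded
absolute weak sense, i.e. `|x i - a| ⊓ u` tends to `0` in the weak topology of `E` for every
`u ≥ 0`. For a net indexed by a directed set, `l` is `atTop`. -/
def UawTendsto {E : Type u} [NormedAddCommGroup E] [NormedSpace ℝ E] [Lattice E]
    {ι : Type v} (l : Filter ι) (x : ι → E) (a : E) : Prop :=
  ∀ u : E, 0 ≤ u → Tendsto (fun i => toWeakSpace ℝ E (|x i - a| ⊓ u)) l (𝓝 0)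

/-- `A` is uaw-compact: every net in `A` has a subnet that is uaw-convergent to a point of `A`.
A subnet of `x : ι → E` is `x ∘ φ`, where `φ : κ → ι` is defined on a directed set `κ` and
is eventually above every given index. Index sets in the universe of `E` suffice to describe
compactness in the uaw-topology. -/
def IsUawCompact {E : Type u} [NormedAddCommGroup E] [NormedSpace ℝ E] [Lattice E]
    (A : Set E) : Prop :=
  ∀ (ι : Type u) [Preorder ι] [IsDirectedOrder ι] [Nonempty ι] (x : ι → E), (∀ i, x i ∈ A) →
    ∃ (κ : Type u) (_ : Preorder κ) (_ : IsDirectedOrder κ) (_ : Nonempty κ) (φ : κ → ι),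
      Tendsto φ atTop atTop ∧ ∃ a ∈ A, UawTendsto atTop (x ∘ φ) a

/-- `A` is relatively uaw-compact: every net in `A` has a subnet that is uaw-convergent to some
point of `E`. -/
def IsRelativelyUawCompact {E : Type u} [NormedAddCommGroup E] [NormedSpace ℝ E] [Lattice E]
    (A : Set E) : Prop :=
  ∀ (ι : Type u) [Preorder ι] [IsDirectedOrder ι] [Nonempty ι] (x : ι → E), (∀ i, x i ∈ A) →
    ∃ (κ : Type u) (_ : Preorder κ) (_ : IsDirectedOrder κ) (_ : Nonempty κ) (φ : κ → ι),
      Tendsto φ atTop atTop ∧ ∃ a : E, UawTendsto atTop (x ∘ φ) a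

/-- `S` is L-weakly compact: it is norm bounded and every disjoint sequence in its solid hull
`{x | ∃ y ∈ S, |x| ≤ |y|}` converges to `0` in norm. -/
def IsLWeaklyCompact {E : Type u} [NormedAddCommGroup E] [Lattice E] (S : Set E) : Prop :=
  Bornology.IsBounded S ∧
    ∀ x : ℕ → E, (∀ n, x n ∈ LatticeOrderedAddCommGroup.solidClosure S) →
      (∀ m n, m ≠ n → |x m| ⊓ |x n| = 0) → Tendsto (fun n => ‖x n‖) atTop (𝓝 0)

/-! ### Inequalities and disjointness in vector lattices. -/

section LatticeGroup

variable {E : Type*} [AddCommGroup E] [Lattice E] [IsOrderedAddMonoid E]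

/-! Everything passes through the domination condition (2), named `DualDominated` below. L-weak
compactness yields it in two stages. First, sol(S) lies within ε of an order interval [-u, u] whose
own disjoint sequences are norm null (`DisjointNull.exists_norm_posPart_le`). Second, up to ε, some
positive functional dominates the norm on [0, u] (`DisjointNull.exists_dual_norm_le`); this needs
increasing sequences in [0, u] to be norm Cauchy. Both stages argue by contradiction:
counterexamples are chosen recursively against rapidly growing data, so that suitable truncations of
them are disjoint or nearly so, hence null.

Conversely, (2) upgrades uaw-convergence in sol(S) to norm convergence, even when the limit is
outside sol(S) (`DualDominated.tendsto_of_uawTendsto`). This gives (3), (4) and (5).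

To return to (1): disjoint sequences are uaw-null, which settles (3). Moreover such a sequence
together with 0 is a uaw-compact set; under (4) or (5) a non-null one would have a nonzero norm
cluster point disjoint from itself. -/

theorem inf_add_le_inf_add_inf {a b c : E} (ha : 0 ≤ a) (hb : 0 ≤ b) (hc : 0 ≤ c) :
    a ⊓ (b + c) ≤ a ⊓ b + a ⊓ c := by
  rw [← sub_le_iff_le_add', sub_inf]
  refine sup_le ((sub_nonpos.2 inf_le_left).trans (le_inf ha hc)) (le_inf ?_ ?_)
  · exact (sub_le_self _ hb).trans inf_le_left
  · exact sub_le_iff_le_add'.2 inf_le_right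

omit [IsOrderedAddMonoid E] in
theorem inf_eq_zero_of_le {a b c d : E} (h : c ⊓ d = 0) (ha : 0 ≤ a) (hb : 0 ≤ b)
    (hac : a ≤ c) (hbd : b ≤ d) : a ⊓ b = 0 :=
  le_antisymm (h ▸ inf_le_inf hac hbd) (le_inf ha hb)

theorem sub_inf_inf_sub_inf (a b : E) : (a - a ⊓ b) ⊓ (b - a ⊓ b) = 0 := by
  rw [← inf_sub, sub_self]

theorem posPart_inf_posPart_le (a b : E) : a⁺ ⊓ b⁺ ≤ (a ⊓ b)⁺ := by
  let _ : DistribLattice E := AddCommGroup.toDistribLattice E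
  simp only [posPart_def]
  exact (sup_inf_right a b 0).ge

theorem le_add_posPart_sub (a b : E) : a ≤ b + (a - b)⁺ :=
  sub_le_iff_le_add'.1 (le_posPart _)

theorem sub_inf_eq_posPart (a b : E) : a - a ⊓ b = (a - b)⁺ := by
  rw [sub_inf, sub_self, sup_comm, posPart_def]

theorem posPart_sub_inf_posPart_sub_eq_zero (a b : E) : (a - b)⁺ ⊓ (b - a)⁺ = 0 := by
  rw [← neg_sub a b, posPart_neg, posPart_inf_negPart_eq_zero]

theorem posPart_sub_le_self {a b : E} (ha : 0 ≤ a) (hb : 0 ≤ b) : (a - b)⁺ ≤ a :=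
  sup_le (sub_le_self _ hb) ha

theorem abs_inf_nonneg {a b : E} (hb : 0 ≤ b) : 0 ≤ |a| ⊓ b := le_inf (abs_nonneg a) hb

theorem abs_sub_le_add_inf (x a : E) : |x - a| ≤ |x - a| ⊓ |x| + |x - a| ⊓ |a| := by
  refine le_trans (le_inf le_rfl ?_)
    (inf_add_le_inf_add_inf (abs_nonneg _) (abs_nonneg x) (abs_nonneg a))
  rw [sub_eq_add_neg, ← abs_neg a]
  exact abs_add_le _ _

variable [Module ℝ E] [IsOrderedModule ℝ E]

omit [IsOrderedAddMonoid E] in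
theorem smul_inf_of_pos {c : ℝ} (hc : 0 < c) (a b : E) : c • (a ⊓ b) = c • a ⊓ c • b := by
  refine le_antisymm (le_inf (smul_le_smul_of_nonneg_left inf_le_left hc.le)
    (smul_le_smul_of_nonneg_left inf_le_right hc.le)) ?_
  have h : c⁻¹ • (c • a ⊓ c • b) ≤ a ⊓ b := by
    refine le_inf ?_ ?_
    · simpa [smul_smul, hc.ne'] using
        smul_le_smul_of_nonneg_left (inf_le_left : c • a ⊓ c • b ≤ c • a) (inv_nonneg.2 hc.le)
    · simpa [smul_smul, hc.ne'] using
        smul_le_smul_of_nonneg_left (inf_le_right : c • a ⊓ c • b ≤ c • b) (inv_nonneg.2 hc.le)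
  simpa [smul_smul, hc.ne'] using smul_le_smul_of_nonneg_left h hc.le

theorem posPart_smul_of_pos {c : ℝ} (hc : 0 < c) (a : E) : (c • a)⁺ = c • a⁺ := by
  rw [← negPart_neg, ← negPart_neg, negPart_eq_neg_inf_zero, negPart_eq_neg_inf_zero, smul_neg,
    smul_inf_of_pos hc, smul_zero, smul_neg]

theorem le_smul_of_one_le {c : ℝ} (hc : 1 ≤ c) {a : E} (ha : 0 ≤ a) : a ≤ c • a := by
  simpa using smul_le_smul_of_nonneg_right hc ha

theorem inf_smul_eq_zero {c : ℝ} (hc : 1 ≤ c) {a b : E} (ha : 0 ≤ a) (hb : 0 ≤ b)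
    (h : a ⊓ b = 0) : a ⊓ c • b = 0 := by
  have hc0 : 0 < c := by linarith
  refine inf_eq_zero_of_le (c := c • a) (d := c • b) ?_ ha (smul_nonneg hc0.le hb)
    (le_smul_of_one_le hc ha) le_rfl
  rw [← smul_inf_of_pos hc0, h, smul_zero]

/-- The meet t is disjoint from (c • p - q)⁺, and c • t ≤ c • p ≤ q + (c • p - q)⁺, so only q can
absorb c • t. For large c the meet is therefore small in norm. -/
theorem smul_inf_posPart_le {c : ℝ} (hc : 1 ≤ c) {p q : E} (hp : 0 ≤ p) (hq : 0 ≤ q) :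
    c • (p ⊓ (q - c • p)⁺) ≤ q := by
  have hc0 : 0 < c := by linarith
  set t := p ⊓ (q - c • p)⁺ with ht
  have ht0 : 0 ≤ t := le_inf hp (posPart_nonneg _)
  have hd : (c • p - q)⁺ ⊓ c • t = 0 := by
    refine inf_smul_eq_zero hc (posPart_nonneg _) ht0 ?_
    exact inf_eq_zero_of_le (posPart_sub_inf_posPart_sub_eq_zero _ _) (posPart_nonneg _) ht0
      le_rfl inf_le_right
  have h1 : c • t ≤ q + (c • p - q)⁺ :=
    (smul_le_smul_of_nonneg_left inf_le_left hc0.le).trans (le_add_posPart_sub _ _)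
  calc c • t ≤ c • t ⊓ (q + (c • p - q)⁺) := le_inf le_rfl h1
    _ ≤ c • t ⊓ q + c • t ⊓ (c • p - q)⁺ :=
      inf_add_le_inf_add_inf (smul_nonneg hc0.le ht0) hq (posPart_nonneg _)
    _ ≤ q := by rw [inf_comm (c • t) (c • p - q)⁺, hd, add_zero]; exact inf_le_right

theorem posPart_sub_smul_inf_eq_zero {c : ℝ} (hc : 1 ≤ c) (u z : E) :
    (u - c • z)⁺ ⊓ (z - c⁻¹ • u)⁺ = 0 := by
  have hc0 : 0 < c := by linarith
  have h : (u - c • z)⁺ ≤ c • (c⁻¹ • u - z)⁺ := by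
    refine sup_le ?_ (smul_nonneg hc0.le (posPart_nonneg _))
    have := smul_le_smul_of_nonneg_left (le_posPart (c⁻¹ • u - z)) hc0.le
    rwa [smul_sub, smul_smul, mul_inv_cancel₀ hc0.ne', one_smul] at this
  rw [inf_comm]
  refine inf_eq_zero_of_le (inf_smul_eq_zero hc (posPart_nonneg _) (posPart_nonneg _)
    (posPart_sub_inf_posPart_sub_eq_zero z (c⁻¹ • u))) (posPart_nonneg _) (posPart_nonneg _)
    le_rfl h

end LatticeGroup

/-! ### Nearly disjoint sequences. -/

section NormedLattice

variable {E : Type*} [NormedAddCommGroup E] [Lattice E] [IsOrderedAddMonoid E] [HasSolidNorm E]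

theorem norm_le_norm_of_nonneg_of_le {a b : E} (ha : 0 ≤ a) (hab : a ≤ b) : ‖a‖ ≤ ‖b‖ :=
  norm_le_norm_of_abs_le_abs (by rwa [abs_of_nonneg ha, abs_of_nonneg (ha.trans hab)])

/-- Every disjoint sequence in `A` is norm null. -/
def DisjointNull (A : Set E) : Prop :=
  ∀ x : ℕ → E, (∀ n, x n ∈ A) → (∀ m n, m ≠ n → |x m| ⊓ |x n| = 0) →
    Tendsto (fun n => ‖x n‖) atTop (𝓝 0)

omit [IsOrderedAddMonoid E] [HasSolidNorm E] in
theorem isSolid_abs_le (u : E) : LatticeOrderedAddCommGroup.IsSolid {x : E | |x| ≤ u} :=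
  fun _ hx _ hyx => hyx.trans hx

/-- In a solid set whose disjoint sequences are null, every positive sequence which is
asymptotically disjoint in norm is null. -/
theorem DisjointNull.tendsto_norm_of_tendsto_norm_inf [CompleteSpace E] {A : Set E}
    (hd : DisjointNull A)
    (hA : LatticeOrderedAddCommGroup.IsSolid A) {y : ℕ → E} (hy : ∀ n, 0 ≤ y n)
    (hyA : ∀ n, y n ∈ A) (h : ∀ n, Tendsto (fun m => ‖y n ⊓ y m‖) atTop (𝓝 0)) :
    Tendsto (fun n => ‖y n‖) atTop (𝓝 0) := by
  by_contra hcon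
  obtain ⟨ε, hε, hfreq⟩ : ∃ ε > 0, ∃ᶠ n in atTop, ε ≤ ‖y n‖ := by
    by_contra! hc
    refine hcon (Metric.tendsto_nhds.2 fun ε hε => ?_)
    filter_upwards [hc ε hε] with n hn
    simpa using hn
  -- Each chosen term is a pair (index, rank). The strictly increasing rank supplies geometric
  -- weights, since the extraction principle does not reveal the position of a term.
  obtain ⟨f, hfP, hfr⟩ := exists_seq_of_forall_finset_exists
    (fun p : ℕ × ℕ => ε ≤ ‖y p.1‖)
    (fun p q => p.2 < q.2 ∧ ‖y p.1 ⊓ y q.1‖ ≤ ε / 4 * (1 / 2) ^ p.2 * (1 / 2) ^ q.2) (by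
      intro s hs
      have hk : ∀ p ∈ s, p.2 < s.sup Prod.snd + 1 := fun p hp =>
        Nat.lt_succ_of_le (Finset.le_sup (f := Prod.snd) hp)
      have hev : ∀ᶠ m in atTop, ∀ p ∈ s,
          ‖y p.1 ⊓ y m‖ ≤ ε / 4 * (1 / 2) ^ p.2 * (1 / 2) ^ (s.sup Prod.snd + 1) := by
        rw [Filter.eventually_all_finset]
        intro p hp
        have hpos : 0 < ε / 4 * (1 / 2 : ℝ) ^ p.2 * (1 / 2) ^ (s.sup Prod.snd + 1) := by
          positivity
        exact ((h p.1).eventually (gt_mem_nhds hpos)).mono fun m hm => hm.le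
      obtain ⟨m, hm1, hm2⟩ := (hfreq.and_eventually hev).exists
      exact ⟨(m, s.sup Prod.snd + 1), hm1, fun p hp => ⟨hk p hp, hm2 p hp⟩⟩)
  have hmono : StrictMono fun i => (f i).2 := fun i j hij => (hfr i j hij).1
  have hpow : ∀ i, (1 / 2 : ℝ) ^ (f i).2 ≤ (1 / 2) ^ i := fun i =>
    pow_le_pow_of_le_one (by norm_num) (by norm_num) (hmono.le_apply)
  set z : ℕ → E := fun i => y (f i).1 with hz
  have hz0 : ∀ i, 0 ≤ z i := fun i => hy _
  have hlt : ∀ i j, i < j → ‖z i ⊓ z j‖ ≤ ε / 4 * (1 / 2) ^ i * (1 / 2) ^ j := by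
    intro i j hij
    refine (hfr i j hij).2.trans ?_
    exact mul_le_mul (mul_le_mul_of_nonneg_left (hpow i) (by positivity)) (hpow j)
      (by positivity) (by positivity)
  have hne : ∀ i j, i ≠ j → ‖z i ⊓ z j‖ ≤ ε / 4 * (1 / 2) ^ j := by
    intro i j hij
    have key : ‖z i ⊓ z j‖ ≤ ε / 4 * (1 / 2) ^ i * (1 / 2) ^ j := by
      rcases lt_or_gt_of_ne hij with h1 | h1
      · exact hlt i j h1
      · rw [inf_comm]; refine (hlt j i h1).trans (le_of_eq (by ring))
    refine key.trans ?_
    have : (1 / 2 : ℝ) ^ i ≤ 1 := pow_le_one₀ (by norm_num) (by norm_num)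
    gcongr
    nlinarith
  let c : ℕ → ℕ → E := fun i j => if i = j then 0 else z i ⊓ z j
  have hc0 : ∀ i j, 0 ≤ c i j := by
    intro i j
    by_cases hij : i = j
    · simp [c, hij]
    · simpa [c, hij] using ⟨hz0 i, hz0 j⟩
  have hcn : ∀ i j, ‖c i j‖ ≤ ε / 4 * (1 / 2) ^ j := by
    intro i j
    by_cases hij : i = j
    · simp only [c, hij, if_true, norm_zero]; positivity
    · simpa only [c, hij, if_false] using hne i j hij
  have hgeo : HasSum (fun j : ℕ => ε / 4 * (1 / 2 : ℝ) ^ j) (ε / 4 * 2) :=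
    hasSum_geometric_two.mul_left _
  have hcs : ∀ i, Summable (c i) := fun i => hgeo.summable.of_norm_bounded (hcn i)
  let s : ℕ → E := fun i => ∑' j, c i j
  have hs0 : ∀ i, 0 ≤ s i := fun i => tsum_nonneg (hc0 i)
  have hsn : ∀ i, ‖s i‖ ≤ ε / 2 := fun i => by
    have := tsum_of_norm_bounded hgeo (hcn i)
    linarith
  have hsle : ∀ i j, i ≠ j → z i ⊓ z j ≤ s i := fun i j hij => by
    have := (hcs i).le_tsum j (fun k _ => hc0 i k)
    simpa [c, hij] using this
  -- Removing the sum s i of all overlaps makes the terms exactly disjoint, at a cost of at most ε /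
  -- 2 in norm.
  let w : ℕ → E := fun i => (z i - s i)⁺
  have hw0 : ∀ i, 0 ≤ w i := fun i => posPart_nonneg _
  have hwz : ∀ i, w i ≤ z i := fun i => posPart_sub_le_self (hz0 i) (hs0 i)
  have hwle : ∀ i j, i ≠ j → w i ≤ z i - z i ⊓ z j := fun i j hij =>
    sup_le (sub_le_sub_left (hsle i j hij) _) (sub_nonneg.2 inf_le_left)
  have hw := hd w (fun i => hA (hyA (f i).1) (by
      rw [abs_of_nonneg (hw0 i), abs_of_nonneg (hy _)]; exact hwz i)) (by
    intro i j hij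
    rw [abs_of_nonneg (hw0 i), abs_of_nonneg (hw0 j)]
    refine inf_eq_zero_of_le (sub_inf_inf_sub_inf (z i) (z j)) (hw0 i) (hw0 j) (hwle i j hij) ?_
    rw [inf_comm (z i)]
    exact hwle j i hij.symm)
  obtain ⟨i, hi⟩ := (hw.eventually (gt_mem_nhds (show (0:ℝ) < ε / 2 by linarith))).exists
  have h1 : ‖z i‖ ≤ ‖s i‖ + ‖w i‖ :=
    (norm_le_norm_of_nonneg_of_le (hz0 i) (le_add_posPart_sub (z i) (s i))).trans (norm_add_le _ _)
  have h2 : ε ≤ ‖z i‖ := hfP i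
  linarith [hsn i]

end NormedLattice

/-! ### Order intervals with null disjoint sequences, and norming positive functionals. -/

section NormedLattice

variable {E : Type*} [NormedAddCommGroup E] [Lattice E] [IsOrderedAddMonoid E] [HasSolidNorm E]

omit [IsOrderedAddMonoid E] [HasSolidNorm E] in
theorem DisjointNull.mono {A B : Set E} (hB : DisjointNull B) (h : A ⊆ B) : DisjointNull A :=
  fun x hx => hB x fun n => h (hx n)

theorem DisjointNull.abs_le_add {a b : E} (ha : DisjointNull {x : E | |x| ≤ a})
    (hb : DisjointNull {x : E | |x| ≤ b}) (ha0 : 0 ≤ a) (hb0 : 0 ≤ b) :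
    DisjointNull {x : E | |x| ≤ a + b} := by
  intro x hx hdisj
  have h0 : ∀ n, 0 ≤ |x n| ⊓ a := fun n => abs_inf_nonneg ha0
  have h1 : ∀ n, 0 ≤ (|x n| - a)⁺ := fun n => posPart_nonneg _
  have h2 : ∀ n, (|x n| - a)⁺ ≤ |x n| := fun n => posPart_sub_le_self (abs_nonneg _) ha0
  have hA := ha (fun n => |x n| ⊓ a) (fun n => by
      simp only [Set.mem_ofPred_eq, abs_of_nonneg (h0 n)]; exact inf_le_right) (fun m n hmn => by
      rw [abs_of_nonneg (h0 m), abs_of_nonneg (h0 n)]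
      exact inf_eq_zero_of_le (hdisj m n hmn) (h0 m) (h0 n) inf_le_left inf_le_left)
  have hB := hb (fun n => (|x n| - a)⁺) (fun n => by
      simp only [Set.mem_ofPred_eq, abs_of_nonneg (h1 n)]
      exact sup_le (sub_le_iff_le_add'.2 (hx n)) hb0) (fun m n hmn => by
      rw [abs_of_nonneg (h1 m), abs_of_nonneg (h1 n)]
      exact inf_eq_zero_of_le (hdisj m n hmn) (h1 m) (h1 n) (h2 m) (h2 n))
  refine squeeze_zero (fun n => norm_nonneg _) (fun n => ?_) (by simpa using hA.add hB)
  rw [← norm_abs_eq_norm (x n), ← sub_inf_eq_posPart]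
  exact (norm_add_le _ _).trans' (by simp)

variable [NormedSpace ℝ E] [IsOrderedModule ℝ E] [CompleteSpace E]

/-- Induction on k = R - r, where r is the multiplicity with which a fits below u beside the w i.
Replacing a by a ⊓ w n spends w n and raises the multiplicity, so by induction the terms are
asymptotically disjoint, hence null. At multiplicity R, a ≤ u / R and nothing is left. -/
theorem DisjointNull.tendsto_norm_posPart_of_sum_le {u : E} (hu : DisjointNull {x : E | |x| ≤ u})
    (hu0 : 0 ≤ u) {R : ℕ} (hR : 0 < R) (k : ℕ) : ∀ (r : ℕ) (a : E) (w : ℕ → E), r + k = R →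
    0 ≤ a → a ≤ u → (∀ n, 0 ≤ w n) →
    (∀ N, (r : ℝ) • a + ∑ i ∈ Finset.range N, w i ≤ u) →
    Tendsto (fun n => ‖(a ⊓ w n - (R : ℝ)⁻¹ • u)⁺‖) atTop (𝓝 0) := by
  have hR0 : (0 : ℝ) < R := by exact_mod_cast hR
  have hRu : 0 ≤ (R : ℝ)⁻¹ • u := smul_nonneg (by positivity) hu0
  induction k with
  | zero =>
    intro r a w hr ha _ _ hs
    obtain rfl : r = R := by simpa using hr
    have hau : a ≤ (r : ℝ)⁻¹ • u := by
      have := smul_le_smul_of_nonneg_left (hs 0) (inv_nonneg.2 hR0.le)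
      simpa [smul_smul, hR0.ne'] using this
    have : ∀ n, (a ⊓ w n - (r : ℝ)⁻¹ • u)⁺ = 0 := fun n =>
      posPart_eq_zero.2 (sub_nonpos.2 (inf_le_left.trans hau))
    simp [this]
  | succ k ih =>
    intro r a w hr ha hau hw hs
    have haw : ∀ n, 0 ≤ a ⊓ w n := fun n => le_inf ha (hw n)
    refine hu.tendsto_norm_of_tendsto_norm_inf (isSolid_abs_le u) (fun n => posPart_nonneg _)
      (fun n => ?_) (fun n => ?_)
    · simp only [Set.mem_ofPred_eq, abs_of_nonneg (posPart_nonneg _)]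
      exact (posPart_sub_le_self (haw n) hRu).trans (inf_le_left.trans hau)
    · rw [← tendsto_add_atTop_iff_nat (n + 1)]
      -- The shift by n + 1 discards w 0, ..., w n from the sum, which makes room for the extra copy
      -- of a ⊓ w n.
      have key := ih (r + 1) (a ⊓ w n) (fun m => w (m + (n + 1))) (by omega) (haw n)
        (inf_le_left.trans hau) (fun m => hw _) (fun N => by
          refine le_trans ?_ (hs (n + 1 + N))
          rw [Finset.sum_range_add, Finset.sum_range_succ]
          push_cast
          rw [add_smul, one_smul]
          have h1 : (r : ℝ) • (a ⊓ w n) ≤ (r : ℝ) • a :=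
            smul_le_smul_of_nonneg_left inf_le_left (by positivity)
          have h2 : 0 ≤ ∑ i ∈ Finset.range n, w i := Finset.sum_nonneg fun i _ => hw i
          have h3 : ∑ i ∈ Finset.range N, w (i + (n + 1)) =
              ∑ i ∈ Finset.range N, w (n + 1 + i) :=
            Finset.sum_congr rfl fun i _ => by rw [add_comm]
          have h4 : a ⊓ w n ≤ ∑ i ∈ Finset.range n, w i + w n :=
            inf_le_right.trans (le_add_of_nonneg_left h2)
          rw [h3, add_assoc]
          exact add_le_add h1 (add_le_add h4 le_rfl))
      refine squeeze_zero (fun m => norm_nonneg _) (fun m => ?_) key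
      refine norm_le_norm_of_nonneg_of_le (le_inf (posPart_nonneg _) (posPart_nonneg _)) ?_
      refine (posPart_inf_posPart_le _ _).trans (posPart_mono ?_)
      rw [← inf_sub]
      refine sub_le_sub_right ?_ _
      exact le_inf inf_le_left (inf_le_right.trans inf_le_right)

theorem DisjointNull.tendsto_norm_of_sum_le {u : E} (hu : DisjointNull {x : E | |x| ≤ u})
    {w : ℕ → E} (hw : ∀ n, 0 ≤ w n) (hs : ∀ N, ∑ i ∈ Finset.range N, w i ≤ u) :
    Tendsto (fun n => ‖w n‖) atTop (𝓝 0) := by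
  have hu0 : 0 ≤ u := by simpa using hs 0
  have hwu : ∀ n, w n ≤ u := fun n =>
    (Finset.single_le_sum (fun i _ => hw i) (Finset.self_mem_range_succ n)).trans (hs (n + 1))
  refine Metric.tendsto_nhds.2 fun ε hε => ?_
  obtain ⟨R, hR⟩ := exists_nat_gt (2 * ‖u‖ / ε)
  have hR0 : (0 : ℝ) < R := lt_of_le_of_lt (by positivity) hR
  have key := hu.tendsto_norm_posPart_of_sum_le hu0 (by exact_mod_cast hR0) R 0 u w (by simp) hu0
    le_rfl hw (fun N => by simpa using hs N)
  filter_upwards [key.eventually (gt_mem_nhds (half_pos hε))] with n hn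
  rw [inf_eq_right.2 (hwu n)] at hn
  have h1 : ‖w n‖ ≤ ‖(R : ℝ)⁻¹ • u‖ + ‖(w n - (R : ℝ)⁻¹ • u)⁺‖ :=
    (norm_le_norm_of_nonneg_of_le (hw n) (le_add_posPart_sub _ _)).trans (norm_add_le _ _)
  have h2 : ‖(R : ℝ)⁻¹ • u‖ < ε / 2 := by
    rw [norm_smul, norm_inv, Real.norm_of_nonneg hR0.le, inv_mul_lt_iff₀ hR0]
    rw [div_lt_iff₀ hε] at hR
    linarith
  simp only [dist_zero_right, norm_norm]
  linarith

/-- Otherwise infinitely many successive increments would have norm at least ε, yet they are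
positive and telescope to sums below u. -/
theorem DisjointNull.cauchySeq_of_monotone {u : E} (hu : DisjointNull {x : E | |x| ≤ u})
    {x : ℕ → E} (hx : Monotone x) (hx0 : ∀ n, 0 ≤ x n) (hxu : ∀ n, x n ≤ u) : CauchySeq x := by
  rw [Metric.cauchySeq_iff']
  by_contra! hcon
  obtain ⟨ε, hε, hN⟩ := hcon
  choose ψ hψ hdist using hN
  let φ : ℕ → ℕ := fun k => ψ^[k] 0
  have hφ : ∀ k, φ (k + 1) = ψ (φ k) := fun k => Function.iterate_succ_apply' ψ k 0
  have key := hu.tendsto_norm_of_sum_le (w := fun k => x (φ (k + 1)) - x (φ k))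
    (fun k => by rw [hφ]; exact sub_nonneg.2 (hx (hψ _)))
    (fun N => by
      rw [Finset.sum_range_sub (fun k => x (φ k))]
      exact (sub_le_self _ (hx0 _)).trans (hxu _))
  obtain ⟨k, hk⟩ := (key.eventually (gt_mem_nhds hε)).exists
  rw [hφ, ← dist_eq_norm] at hk
  exact absurd (hdist (φ k)) (not_le.2 hk)

/-- A bounded solid set whose disjoint sequences are null is, up to `ε`, contained in an order
interval whose disjoint sequences are null. -/
theorem DisjointNull.exists_norm_posPart_le {A : Set E} (hd : DisjointNull A)
    (hA : LatticeOrderedAddCommGroup.IsSolid A) (hb : Bornology.IsBounded A) {ε : ℝ}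
    (hε : 0 < ε) : ∃ u : E, 0 ≤ u ∧ DisjointNull {x : E | |x| ≤ u} ∧
      ∀ x ∈ A, ‖(|x| - u)⁺‖ ≤ ε := by
  by_contra! hcon
  have habs : ∀ x ∈ A, DisjointNull {y : E | |y| ≤ |x|} := fun x hx =>
    hd.mono fun y hy => hA hx hy
  have hcon' : ∀ p : {u : E // 0 ≤ u ∧ DisjointNull {x : E | |x| ≤ u}},
      ∃ x ∈ A, ε < ‖(|x| - p.1)⁺‖ := fun p => hcon p.1 p.2.1 p.2.2
  choose f hfA hf using hcon'
  -- Doubling the bound and adding the new counterexample gives 2 ^ k • |f (U n)| ≤ U (n + 1 + k),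
  -- so later remainders meet earlier ones in norm at most a constant times 2⁻ᵏ.
  let step : {u : E // 0 ≤ u ∧ DisjointNull {x : E | |x| ≤ u}} →
      {u : E // 0 ≤ u ∧ DisjointNull {x : E | |x| ≤ u}} := fun p =>
    ⟨p.1 + p.1 + |f p|, add_nonneg (add_nonneg p.2.1 p.2.1) (abs_nonneg _),
      (p.2.2.abs_le_add p.2.2 p.2.1 p.2.1).abs_le_add (habs _ (hfA p))
        (add_nonneg p.2.1 p.2.1) (abs_nonneg _)⟩
  let U : ℕ → {u : E // 0 ≤ u ∧ DisjointNull {x : E | |x| ≤ u}} := fun n =>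
    step^[n] ⟨0, le_rfl, fun x hx _ => by
      have h0 : ∀ n, ‖x n‖ = 0 := fun n => by
        rw [← norm_abs_eq_norm, le_antisymm (hx n) (abs_nonneg _), norm_zero]
      simp only [h0, tendsto_const_nhds]⟩
  have hU : ∀ n, (U (n + 1)).1 = (U n).1 + (U n).1 + |f (U n)| := fun n => by
    simp only [U, Function.iterate_succ_apply', step]
  have hU0 : ∀ n, 0 ≤ (U n).1 := fun n => (U n).2.1
  have hge : ∀ n k, (2 : ℝ) ^ k • |f (U n)| ≤ (U (n + 1 + k)).1 := by
    intro n k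
    induction k with
    | zero => simpa [hU n] using add_nonneg (hU0 n) (hU0 n)
    | succ k ih =>
      rw [← add_assoc, hU, pow_succ', mul_smul, two_smul]
      exact (add_le_add ih ih).trans (le_add_of_nonneg_right (abs_nonneg _))
  obtain ⟨K, hK⟩ := hb.exists_norm_le
  let w : ℕ → E := fun n => (|f (U n)| - (U n).1)⁺
  have hwle : ∀ n, w n ≤ |f (U n)| := fun n => posPart_sub_le_self (abs_nonneg _) (hU0 n)
  have hw0 : ∀ n, 0 ≤ w n := fun n => posPart_nonneg _
  have key := hd.tendsto_norm_of_tendsto_norm_inf hA (y := w) hw0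
    (fun n => hA (hfA (U n)) (by rw [abs_of_nonneg (hw0 n)]; exact hwle n)) (fun n => by
      rw [← tendsto_add_atTop_iff_nat (n + 1)]
      have hlim : Tendsto (fun k : ℕ => (1 / 2 : ℝ) ^ k * K) atTop (𝓝 0) := by
        simpa using (tendsto_pow_atTop_nhds_zero_of_lt_one (r := (1 / 2 : ℝ)) (by norm_num)
          (by norm_num)).mul_const K
      refine squeeze_zero (fun m => norm_nonneg _) (fun k => ?_) hlim
      have hc : (1 : ℝ) ≤ 2 ^ k := one_le_pow₀ (by norm_num)
      have ht0 : 0 ≤ w n ⊓ w (k + (n + 1)) := le_inf (hw0 _) (hw0 _)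
      have hle : w n ⊓ w (k + (n + 1)) ≤
          |f (U n)| ⊓ (|f (U (k + (n + 1)))| - (2 : ℝ) ^ k • |f (U n)|)⁺ := by
        refine inf_le_inf (hwle n) (posPart_mono (sub_le_sub_left ?_ _))
        have := hge n k
        rwa [add_comm (n + 1)] at this
      have h1 := (smul_le_smul_of_nonneg_left hle (by positivity : (0 : ℝ) ≤ 2 ^ k)).trans
        (smul_inf_posPart_le hc (abs_nonneg (f (U n))) (abs_nonneg (f (U (k + (n + 1))))))
      have h2 := norm_le_norm_of_nonneg_of_le (smul_nonneg (by positivity) ht0) h1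
      rw [norm_smul, norm_abs_eq_norm, norm_pow, Real.norm_of_nonneg (by norm_num)] at h2
      have h3 := h2.trans (hK _ (hfA _))
      rw [one_div, inv_pow, ← div_eq_inv_mul, le_div_iff₀ (by positivity)]
      linarith)
  obtain ⟨n, hn⟩ := (key.eventually (gt_mem_nhds hε)).exists
  exact absurd (hf (U n)) (not_lt.2 hn.le)

omit [CompleteSpace E] in
-- Hahn–Banach with the sublinear map y ↦ ‖y⁺‖: it vanishes on the negative cone, which forces the
-- extension to be positive.
theorem exists_positive_dual_eq_norm {x : E} (hx : 0 ≤ x) : ∃ f : StrongDual ℝ E,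
    (∀ y, 0 ≤ y → 0 ≤ f y) ∧ (∀ y, ‖f y‖ ≤ ‖y‖) ∧ f x = ‖x‖ := by
  rcases eq_or_ne x 0 with rfl | hx0
  · exact ⟨0, by simp⟩
  obtain ⟨g, hg, hgle⟩ := exists_extension_of_le_sublinear
    (LinearPMap.mkSpanSingleton x ‖x‖ hx0) (fun y => ‖y⁺‖)
    (fun c hc y => by rw [posPart_smul_of_pos hc, norm_smul, Real.norm_of_nonneg hc.le])
    (fun y z => by
      refine (norm_le_norm_of_nonneg_of_le (posPart_nonneg _) ?_).trans (norm_add_le _ _)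
      exact sup_le (add_le_add (le_posPart _) (le_posPart _))
        (add_nonneg (posPart_nonneg _) (posPart_nonneg _)))
    (by
      rintro ⟨y, hy⟩
      obtain ⟨c, rfl⟩ := Submodule.mem_span_singleton.1 hy
      refine (LinearPMap.mkSpanSingleton'_apply x ‖x‖ _ c hy).trans_le ?_
      rcases le_total 0 c with hc | hc
      · rw [posPart_eq_self.2 (by exact smul_nonneg hc hx), norm_smul, Real.norm_of_nonneg hc]
        exact le_rfl
      · exact (mul_nonpos_of_nonpos_of_nonneg hc (norm_nonneg _)).trans (norm_nonneg _))
  have hpn : ∀ y : E, ‖y⁺‖ ≤ ‖y‖ := fun y => norm_le_norm_of_abs_le_abs (by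
    rw [abs_of_nonneg (posPart_nonneg _)]; exact sup_le (le_abs_self _) (abs_nonneg _))
  have hbd : ∀ y, ‖g y‖ ≤ 1 * ‖y‖ := fun y => by
    rw [one_mul, Real.norm_eq_abs, abs_le]
    constructor
    · have := (hgle (-y)).trans (hpn _)
      rw [map_neg, norm_neg] at this
      linarith
    · exact (hgle y).trans (hpn _)
  refine ⟨g.mkContinuous 1 hbd, fun y hy => ?_, fun y => by simpa using hbd y, ?_⟩
  · have := hgle (-y)
    rw [posPart_eq_zero.2 (neg_nonpos.2 hy), norm_zero, map_neg] at this
    simpa using this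
  · have := hg ⟨x, Submodule.mem_span_singleton_self x⟩
    rw [LinearMap.mkContinuous_apply, this]
    exact LinearPMap.mkSpanSingleton_apply _ _ hx0 _

end NormedLattice

/-! ### Dominating the norm on an order interval by a functional. -/

section NormedLattice

variable {E : Type*} [NormedAddCommGroup E] [Lattice E] [IsOrderedAddMonoid E] [HasSolidNorm E]
variable [NormedSpace ℝ E] [IsOrderedModule ℝ E]

omit [HasSolidNorm E] [IsOrderedModule ℝ E] in
theorem StrongDual.mono_of_nonneg {f : StrongDual ℝ E} (hf : ∀ y, 0 ≤ y → 0 ≤ f y) {x y : E}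
    (h : x ≤ y) : f x ≤ f y := by
  have := hf _ (sub_nonneg.2 h)
  rwa [map_sub, sub_nonneg] at this

theorem DisjointNull.exists_dual_norm_le [CompleteSpace E] {u : E}
    (hu : DisjointNull {x : E | |x| ≤ u}) (hu0 : 0 ≤ u) {ε : ℝ} (hε : 0 < ε) :
    ∃ g : StrongDual ℝ E, (∀ x, 0 ≤ x → 0 ≤ g x) ∧ ∀ z, 0 ≤ z → z ≤ u → ‖z‖ ≤ g z + ε := by
  by_contra! hcon
  have hcon' : ∀ p : {g : StrongDual ℝ E // ∀ x, 0 ≤ x → 0 ≤ g x},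
      ∃ z, 0 ≤ z ∧ z ≤ u ∧ p.1 z + ε < ‖z‖ := fun p => hcon p.1 p.2
  choose Z hZ0 hZu hZ using hcon'
  choose F hF0 hFn hF using fun p => exists_positive_dual_eq_norm (hZ0 p)
  -- C makes u / C cost at most ε / 4. Then q = 2C² makes C times the geometric tail bound 2‖u‖ / q
  -- equal to ‖u‖ / C, again at most ε / 4.
  obtain ⟨C, hC⟩ := exists_nat_gt (4 * ‖u‖ / ε + 1)
  have hun : 0 ≤ 4 * ‖u‖ / ε := by positivity
  have hC1 : (1 : ℝ) ≤ C := by linarith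
  have hC0 : (0 : ℝ) < C := by linarith
  have hCu : ‖u‖ ≤ C * (ε / 4) := by
    have : 4 * ‖u‖ / ε < C := by linarith
    rw [div_lt_iff₀ hε] at this
    linarith
  set q : ℝ := 2 * C * C with hq
  have hq0 : 0 < q := by positivity
  -- The next functional dominates q times each norming functional so far; as G m (z m) ≤ ‖u‖,
  -- earlier f n decay geometrically along later z m.
  let step : {g : StrongDual ℝ E // ∀ x, 0 ≤ x → 0 ≤ g x} →
      {g : StrongDual ℝ E // ∀ x, 0 ≤ x → 0 ≤ g x} := fun p =>
    ⟨q • (p.1 + F p), fun x hx => mul_nonneg hq0.le (add_nonneg (p.2 x hx) (hF0 p x hx))⟩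
  let G : ℕ → {g : StrongDual ℝ E // ∀ x, 0 ≤ x → 0 ≤ g x} := fun n =>
    step^[n] ⟨0, fun x _ => le_rfl⟩
  have hG : ∀ n x, (G (n + 1)).1 x = q * ((G n).1 x + F (G n) x) := fun n x => by
    simp only [G, Function.iterate_succ_apply', step]
    rfl
  let z : ℕ → E := fun n => Z (G n)
  have hz0 : ∀ n, 0 ≤ z n := fun n => hZ0 _
  have hzu : ∀ n, z n ≤ u := fun n => hZu _
  let f : ℕ → StrongDual ℝ E := fun n => F (G n)
  have hf0 : ∀ n x, 0 ≤ x → 0 ≤ f n x := fun n => hF0 _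
  have hfn : ∀ n x, f n x ≤ ‖x‖ := fun n x => (le_abs_self _).trans (hFn _ x)
  have hge : ∀ n k x, 0 ≤ x → q ^ (k + 1) * f n x ≤ (G (n + 1 + k)).1 x := by
    intro n k x hx
    induction k with
    | zero =>
      rw [add_zero, hG, zero_add, pow_one]
      exact mul_le_mul_of_nonneg_left (le_add_of_nonneg_left ((G n).2 x hx)) hq0.le
    | succ k ih =>
      rw [← add_assoc, hG, pow_succ', mul_assoc]
      exact mul_le_mul_of_nonneg_left (ih.trans (le_add_of_nonneg_right (hF0 _ x hx))) hq0.le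
  have hfz : ∀ n k, f n (z (n + 1 + k)) ≤ ‖u‖ * q⁻¹ ^ (k + 1) := by
    intro n k
    have h1 := hge n k _ (hz0 (n + 1 + k))
    have h2 : (G (n + 1 + k)).1 (z (n + 1 + k)) ≤ ‖u‖ :=
      ((le_add_of_nonneg_right hε.le).trans (hZ (G (n + 1 + k))).le).trans
        (norm_le_norm_of_nonneg_of_le (hz0 _) (hzu _))
    rw [inv_pow, ← div_eq_mul_inv, le_div_iff₀ (by positivity)]
    linarith
  have hqi : q⁻¹ ≤ 1 / 2 := by
    rw [inv_le_comm₀ hq0 (by norm_num)]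
    nlinarith
  have hsum : ∀ n N, f n (∑ k ∈ Finset.range N, z (n + 1 + k)) ≤ ‖u‖ * (2 * q⁻¹) := by
    intro n N
    have hgeo : ∑ k ∈ Finset.range N, q⁻¹ ^ k ≤ 2 := by
      refine (Finset.sum_le_sum fun k _ => pow_le_pow_left₀ (by positivity) hqi k).trans ?_
      exact sum_geometric_two_le N
    calc f n (∑ k ∈ Finset.range N, z (n + 1 + k))
        = ∑ k ∈ Finset.range N, f n (z (n + 1 + k)) := map_sum _ _ _
      _ ≤ ∑ k ∈ Finset.range N, ‖u‖ * q⁻¹ ^ (k + 1) := Finset.sum_le_sum fun k _ => hfz n k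
      _ = ‖u‖ * q⁻¹ * ∑ k ∈ Finset.range N, q⁻¹ ^ k := by
        rw [Finset.mul_sum]; exact Finset.sum_congr rfl fun k _ => by ring
      _ ≤ ‖u‖ * q⁻¹ * 2 := mul_le_mul_of_nonneg_left hgeo (by positivity)
      _ = _ := by ring
  -- The series of the z's need not converge; truncating its partial sums at u makes them increasing
  -- and order bounded, hence Cauchy. The limit s n dominates (C • z m) ⊓ u for every m > n.
  let P : ℕ → ℕ → E := fun n N => ((C : ℝ) • ∑ k ∈ Finset.range N, z (n + 1 + k)) ⊓ u
  have hP0 : ∀ n N, 0 ≤ P n N := fun n N =>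
    le_inf (smul_nonneg hC0.le (Finset.sum_nonneg fun k _ => hz0 _)) hu0
  have hPmono : ∀ n, Monotone (P n) := fun n => monotone_nat_of_le_succ fun N => by
    refine inf_le_inf_right _ (smul_le_smul_of_nonneg_left ?_ hC0.le)
    rw [Finset.sum_range_succ]
    exact le_add_of_nonneg_right (hz0 _)
  choose s hs using fun n => cauchySeq_tendsto_of_complete
    (hu.cauchySeq_of_monotone (hPmono n) (hP0 n) (fun N => inf_le_right))
  have hPs : ∀ n N, P n N ≤ s n := fun n N => (hPmono n).ge_of_tendsto (hs n) N
  have hs0 : ∀ n, 0 ≤ s n := fun n => (hP0 n 0).trans (hPs n 0)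
  have hfs : ∀ n, f n (s n) ≤ ε / 4 := fun n => by
    refine le_of_tendsto (((f n).continuous.tendsto _).comp (hs n)) (Eventually.of_forall fun N => ?_)
    refine (StrongDual.mono_of_nonneg (hf0 n) inf_le_left).trans ?_
    rw [map_smul, smul_eq_mul]
    refine (mul_le_mul_of_nonneg_left (hsum n N) hC0.le).trans ?_
    have : C * (‖u‖ * (2 * q⁻¹)) = ‖u‖ / C := by
      rw [hq]; field_simp
    rw [this, div_le_iff₀ hC0]
    linarith
  have hsz : ∀ m n, n < m → ((C : ℝ) • z m) ⊓ u ≤ s n := fun m n hnm => by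
    obtain ⟨k, rfl⟩ := Nat.exists_eq_add_of_lt hnm
    refine le_trans (inf_le_inf_right _ (smul_le_smul_of_nonneg_left ?_ hC0.le)) (hPs n (k + 1))
    rw [show n + k + 1 = n + 1 + k by ring]
    exact Finset.single_le_sum (f := fun k => z (n + 1 + k)) (fun i _ => hz0 _)
      (Finset.self_mem_range_succ k)
  have hCu0 : 0 ≤ (C : ℝ)⁻¹ • u := smul_nonneg (by positivity) hu0
  -- For n < m, w n ≤ (u - C • z m)⁺ because of s n, while w m ≤ (z m - u / C)⁺; these bounds are
  -- disjoint. As f n is small on s n and on u / C, w n cannot be small in norm.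
  let w : ℕ → E := fun n => (z n - (s n + (C : ℝ)⁻¹ • u))⁺
  have hw0 : ∀ n, 0 ≤ w n := fun n => posPart_nonneg _
  have hwu : ∀ n, w n ≤ u := fun n =>
    (posPart_sub_le_self (hz0 n) (add_nonneg (hs0 n) hCu0)).trans (hzu n)
  have hdisj : ∀ m n, n < m → w n ⊓ w m = 0 := by
    intro m n hnm
    refine inf_eq_zero_of_le (posPart_sub_smul_inf_eq_zero hC1 u (z m)) (hw0 n) (hw0 m) ?_ ?_
    · refine (posPart_mono (sub_le_sub_left (le_add_of_nonneg_right hCu0) _)).trans ?_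
      rw [← sub_inf_eq_posPart, inf_comm]
      refine sup_le (sub_le_sub (hzu n) (hsz m n hnm)) (sub_nonneg.2 inf_le_right)
    · exact posPart_mono (sub_le_sub_left (le_add_of_nonneg_left (hs0 m)) _)
  have key := hu w (fun n => by simpa [abs_of_nonneg (hw0 n)] using hwu n) (fun m n hmn => by
    rw [abs_of_nonneg (hw0 m), abs_of_nonneg (hw0 n)]
    rcases lt_or_gt_of_ne hmn with h | h
    · exact hdisj n m h
    · rw [inf_comm]; exact hdisj m n h)
  obtain ⟨n, hn⟩ := (key.eventually (gt_mem_nhds (half_pos hε))).exists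
  have h1 : f n (z n) ≤ f n (s n) + f n ((C : ℝ)⁻¹ • u) + f n (w n) := by
    rw [← map_add, ← map_add]
    exact StrongDual.mono_of_nonneg (hf0 n) (le_add_posPart_sub _ _)
  have h2 : f n (z n) = ‖z n‖ := hF (G n)
  have h3 : ε < ‖z n‖ := (le_add_of_nonneg_left ((G n).2 _ (hz0 n))).trans_lt (hZ (G n))
  have h4 : f n ((C : ℝ)⁻¹ • u) ≤ ε / 4 := by
    rw [map_smul, smul_eq_mul, inv_mul_le_iff₀ hC0]
    exact (hfn n u).trans hCu
  linarith [hfs n, hfn n (w n)]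

end NormedLattice

/-! ### Testing uaw-convergence on functionals. -/

section Uaw

variable {E : Type u} [NormedAddCommGroup E] [NormedSpace ℝ E] [Lattice E]

theorem uawTendsto_iff {ι : Type v} {l : Filter ι} {x : ι → E} {a : E} :
    UawTendsto l x a ↔ ∀ w : E, 0 ≤ w → ∀ f : StrongDual ℝ E,
      Tendsto (fun i => f (|x i - a| ⊓ w)) l (𝓝 0) := by
  have hinj : Function.Injective (topDualPairing ℝ E).flip := by
    intro x y h
    exact (SeparatingDual.eq_iff_forall_dual_eq (R := ℝ)).2 fun f => DFunLike.congr_fun h f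
  refine forall₂_congr fun w _ => ?_
  refine (WeakBilin.tendsto_iff_forall_eval_tendsto _ hinj).trans (forall_congr' fun f => ?_)
  have h : (topDualPairing ℝ E).flip 0 f = 0 := map_zero f
  exact Iff.of_eq (congrArg (fun t => Tendsto _ l (𝓝 t)) h)

theorem UawTendsto.comp {ι κ : Type*} {l : Filter ι} {x : ι → E} {a : E} (h : UawTendsto l x a)
    {k : Filter κ} {φ : κ → ι} (hφ : Tendsto φ k l) : UawTendsto k (x ∘ φ) a :=
  fun w hw => (h w hw).comp hφ

end Uaw

/-! ### Disjoint sequences are uaw-null. -/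

section Disjoint

variable {E : Type u} [NormedAddCommGroup E] [Lattice E] [IsOrderedAddMonoid E]

theorem inf_sum_eq_zero {ι : Type*} {s : Finset ι} {a : E} {y : ι → E} (ha : 0 ≤ a)
    (hy : ∀ i ∈ s, 0 ≤ y i) (h : ∀ i ∈ s, a ⊓ y i = 0) : a ⊓ ∑ i ∈ s, y i = 0 := by
  classical
  induction s using Finset.induction_on with
  | empty => simpa using ha
  | insert i s hi ih =>
    have hs := fun j hj => hy j (Finset.mem_insert_of_mem hj)
    have h1 := hy i (Finset.mem_insert_self i s)
    rw [Finset.sum_insert hi]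
    refine le_antisymm ?_ (le_inf ha (add_nonneg h1 (Finset.sum_nonneg hs)))
    refine (inf_add_le_inf_add_inf ha h1 (Finset.sum_nonneg hs)).trans ?_
    rw [h i (Finset.mem_insert_self i s), ih hs fun j hj => h j (Finset.mem_insert_of_mem hj),
      add_zero]

theorem sum_le_of_pairwise_disjoint {ι : Type*} {s : Finset ι} {w : E} {y : ι → E} (hw : 0 ≤ w)
    (hy : ∀ i, 0 ≤ y i) (hyw : ∀ i, y i ≤ w) (h : ∀ i j, i ≠ j → y i ⊓ y j = 0) :
    ∑ i ∈ s, y i ≤ w := by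
  classical
  induction s using Finset.induction_on with
  | empty => simpa using hw
  | insert i s hi ih =>
    rw [Finset.sum_insert hi, ← inf_add_sup, inf_sum_eq_zero (hy i) (fun j _ => hy j)
      (fun j hj => h i j (by rintro rfl; exact hi hj)), zero_add]
    exact sup_le (hyw i) ih

variable [HasSolidNorm E] [NormedSpace ℝ E]

theorem summable_dual_of_pairwise_disjoint {w : E} {y : ℕ → E} (hw : 0 ≤ w) (hy : ∀ i, 0 ≤ y i)
    (hyw : ∀ i, y i ≤ w) (h : ∀ i j, i ≠ j → y i ⊓ y j = 0) (f : StrongDual ℝ E) :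
    Summable fun n => |f (y n)| := by
  refine summable_of_sum_range_le (c := ‖f‖ * ‖w‖) (fun n => abs_nonneg _) fun N => ?_
  -- Signs are chosen so that f (t i) = |f (y i)|; by disjointness the signed partial sums still
  -- stay within [-w, w].
  let t : ℕ → E := fun i => if 0 ≤ f (y i) then y i else -y i
  have ht : ∀ i, |t i| = y i := fun i => by
    by_cases hi : 0 ≤ f (y i) <;> simp [t, hi, abs_of_nonneg (hy i)]
  have hft : ∀ i, f (t i) = |f (y i)| := fun i => by
    by_cases hi : 0 ≤ f (y i)
    · simp [t, hi, abs_of_nonneg hi]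
    · simp [t, hi, abs_of_neg (not_le.1 hi)]
  have hsum : |∑ i ∈ Finset.range N, t i| ≤ |w| := by
    rw [abs_of_nonneg hw]
    refine le_trans ?_ (sum_le_of_pairwise_disjoint (s := Finset.range N) hw hy hyw h)
    refine (Finset.le_sum_of_subadditive (fun x : E => |x|) abs_zero.le abs_add_le _ _).trans_eq ?_
    exact Finset.sum_congr rfl fun i _ => ht i
  calc ∑ i ∈ Finset.range N, |f (y i)| = f (∑ i ∈ Finset.range N, t i) := by
        rw [map_sum]; exact Finset.sum_congr rfl fun i _ => (hft i).symm
    _ ≤ ‖f (∑ i ∈ Finset.range N, t i)‖ := le_abs_self _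
    _ ≤ ‖f‖ * ‖∑ i ∈ Finset.range N, t i‖ := f.le_opNorm _
    _ ≤ ‖f‖ * ‖w‖ := by gcongr; exact norm_le_norm_of_abs_le_abs hsum

/-- Pairwise disjoint sequences are uaw-null. -/
theorem uawTendsto_zero_of_pairwise_disjoint {x : ℕ → E}
    (h : ∀ m n, m ≠ n → |x m| ⊓ |x n| = 0) : UawTendsto atTop x 0 := by
  refine uawTendsto_iff.2 fun w hw f => ?_
  simp only [sub_zero]
  refine (tendsto_zero_iff_abs_tendsto_zero _).2 (summable_dual_of_pairwise_disjoint hw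
    (fun i => abs_inf_nonneg hw) (fun i => inf_le_right) (fun i j hij => ?_) f).tendsto_atTop_zero
  exact inf_eq_zero_of_le (h i j hij) (abs_inf_nonneg hw) (abs_inf_nonneg hw) inf_le_left
    inf_le_left

end Disjoint

/-! ### Compactness through subnets and subsequences. -/

section UawCompact

variable {E : Type u} [NormedAddCommGroup E] [NormedSpace ℝ E] [Lattice E]

theorem IsUawCompact.isRelativelyUawCompact {A : Set E} (hA : IsUawCompact A) :
    IsRelativelyUawCompact A := fun ι _ _ _ x hx => by
  obtain ⟨κ, i1, i2, i3, φ, hφ, a, -, ha⟩ := hA ι x hx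
  exact ⟨κ, i1, i2, i3, φ, hφ, a, ha⟩

theorem isUawCompact_insert_range [IsOrderedAddMonoid E] {y : ℕ → E} (hy : UawTendsto atTop y 0) :
    IsUawCompact (insert 0 (Set.range y)) := by
  intro ι _ _ _ x hx
  -- Either the net takes some value frequently, giving a constant subnet, or it eventually leaves
  -- every finite set, and then the whole net follows y to 0.
  by_cases hcon : ∃ a ∈ insert 0 (Set.range y), ∃ᶠ i in atTop, x i = a
  · obtain ⟨a, ha, hfreq⟩ := hcon
    rw [frequently_atTop] at hfreq
    refine ⟨{i // x i = a}, inferInstance, ⟨fun p q => ?_⟩, ?_, Subtype.val, ?_, a, ha, ?_⟩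
    · obtain ⟨k, hpk, hqk⟩ := exists_ge_ge p.1 q.1
      obtain ⟨l, hkl, hl⟩ := hfreq k
      exact ⟨⟨l, hl⟩, hpk.trans hkl, hqk.trans hkl⟩
    · obtain ⟨l, -, hl⟩ := hfreq (Classical.arbitrary ι)
      exact ⟨⟨l, hl⟩⟩
    · refine tendsto_atTop.2 fun b => ?_
      obtain ⟨l, hbl, hl⟩ := hfreq b
      exact (eventually_ge_atTop (⟨l, hl⟩ : {i // x i = a})).mono fun p hp => hbl.trans hp
    · refine uawTendsto_iff.2 fun w hw f => ?_
      have : ∀ p : {i // x i = a}, f (|(x ∘ Subtype.val) p - a| ⊓ w) = 0 := fun p => by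
        rw [Function.comp_apply, p.2, sub_self, abs_zero, inf_eq_left.2 hw, map_zero]
      simp only [this, tendsto_const_nhds]
  · have hne : ∀ a ∈ insert 0 (Set.range y), ∀ᶠ i in atTop, x i ≠ a := fun a ha =>
      not_frequently.1 fun h => hcon ⟨a, ha, h⟩
    refine ⟨ι, inferInstance, inferInstance, inferInstance, id, tendsto_id, 0,
      Set.mem_insert _ _, ?_⟩
    have hex : ∀ i, ∃ n, x i ≠ 0 → y n = x i := fun i => by
      rcases hx i with h | ⟨n, hn⟩
      · exact ⟨0, fun h' => absurd h h'⟩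
      · exact ⟨n, fun _ => hn⟩
    choose n hn using hex
    have h0 := hne 0 (Set.mem_insert _ _)
    have hntop : Tendsto n atTop atTop := by
      refine tendsto_atTop.2 fun b => ?_
      have hall : ∀ᶠ i in atTop, ∀ k ∈ Finset.range b, x i ≠ y k :=
        (Filter.eventually_all_finset _).2 fun k _ =>
          hne _ (Set.mem_insert_of_mem _ (Set.mem_range_self k))
      filter_upwards [h0, hall] with i hi0 hi
      by_contra! hlt
      exact hi _ (Finset.mem_range.2 hlt) (hn i hi0).symm
    intro w hw
    refine (hy.comp hntop w hw).congr' ?_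
    filter_upwards [h0] with i hi
    simp only [Function.comp_apply, hn i hi, id]

theorem isCompact_closure_of_forall_seq {X : Type*} [PseudoMetricSpace X] {A : Set X}
    (h : ∀ x : ℕ → X, (∀ n, x n ∈ A) →
      ∃ a, ∃ φ : ℕ → ℕ, StrictMono φ ∧ Tendsto (x ∘ φ) atTop (𝓝 a)) : IsCompact (closure A) := by
  refine IsSeqCompact.isCompact fun y hy => ?_
  have hex : ∀ n : ℕ, ∃ z ∈ A, dist (y n) z < 1 / (n + 1 : ℝ) := fun n =>
    Metric.mem_closure_iff.1 (hy n) _ Nat.one_div_pos_of_nat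
  choose z hzA hz using hex
  obtain ⟨a, φ, hφ, ha⟩ := h z hzA
  have hlim : Tendsto (y ∘ φ) atTop (𝓝 a) := by
    refine (tendsto_iff_of_dist (squeeze_zero (fun _ => dist_nonneg) (fun n => (hz (φ n)).le)
      (tendsto_one_div_add_atTop_nhds_zero_nat.comp hφ.tendsto_atTop))).2 ha
  exact ⟨a, mem_closure_of_tendsto ha (Eventually.of_forall fun n => hzA _), φ, hφ, hlim⟩

theorem exists_subseq_of_subnet {X : Type u} [TopologicalSpace X] [FirstCountableTopology X]
    {x : ℕ → X} {κ : Type u} [Preorder κ] [IsDirectedOrder κ] [Nonempty κ]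
    {φ : κ → ULift.{u} ℕ} (hφ : Tendsto φ atTop atTop) {a : X}
    (h : Tendsto (fun k => x (φ k).down) atTop (𝓝 a)) :
    ∃ ψ : ℕ → ℕ, StrictMono ψ ∧ Tendsto (x ∘ ψ) atTop (𝓝 a) := by
  have hdown : Tendsto (ULift.down : ULift.{u} ℕ → ℕ) atTop atTop :=
    tendsto_atTop.2 fun b => (eventually_ge_atTop (ULift.up b)).mono fun i hi => hi
  have hc : MapClusterPt a atTop x := (h.mapClusterPt).of_comp (hdown.comp hφ)
  exact hc.tendsto_subseq

end UawCompact

/-! ### From domination to norm convergence, and back from compactness. -/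

section DualDominated

variable {E : Type u} [NormedAddCommGroup E] [NormedSpace ℝ E] [Lattice E]

/-- Up to every `ε > 0`, the norm on `A` is dominated by a positive functional composed with a
truncation. -/
def DualDominated (A : Set E) : Prop :=
  ∀ ε : ℝ, 0 < ε → ∃ g : StrongDual ℝ E, (∀ x : E, 0 ≤ x → 0 ≤ g x) ∧
    ∃ u : E, 0 ≤ u ∧ ∀ x ∈ A, ‖x‖ ≤ g (|x| ⊓ u) + ε

variable [IsOrderedAddMonoid E] [HasSolidNorm E] [IsOrderedModule ℝ E]

theorem DisjointNull.dualDominated [CompleteSpace E] {A : Set E} (hd : DisjointNull A)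
    (hA : LatticeOrderedAddCommGroup.IsSolid A) (hb : Bornology.IsBounded A) :
    DualDominated A := by
  intro ε hε
  obtain ⟨u, hu0, hu, huA⟩ := hd.exists_norm_posPart_le hA hb (half_pos hε)
  obtain ⟨g, hg0, hg⟩ := hu.exists_dual_norm_le hu0 (half_pos hε)
  refine ⟨g, hg0, u, hu0, fun x hx => ?_⟩
  have h1 : ‖x‖ ≤ ‖|x| ⊓ u‖ + ‖(|x| - u)⁺‖ := by
    rw [← norm_abs_eq_norm x, ← sub_inf_eq_posPart]
    exact (norm_add_le _ _).trans' (by simp)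
  linarith [hg _ (abs_inf_nonneg hu0 : 0 ≤ |x| ⊓ u) inf_le_right, huA x hx]

variable {A : Set E} {ι : Type*} {l : Filter ι} {x : ι → E} {a : E}

/-- An estimate of the norm by a truncated positive functional on a solid set extends to the
order intervals generated by uaw-limits. -/
theorem UawTendsto.norm_le_of_abs_le [l.NeBot] (h : UawTendsto l x a)
    (hA : LatticeOrderedAddCommGroup.IsSolid A) (hxA : ∀ i, x i ∈ A) {g : StrongDual ℝ E}
    (hg : ∀ x : E, 0 ≤ x → 0 ≤ g x) {u : E} {ε : ℝ} (hgA : ∀ x ∈ A, ‖x‖ ≤ g (|x| ⊓ u) + ε)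
    {z : E} (hz : |z| ≤ |a|) : ‖z‖ ≤ g (|z| ⊓ u) + ε := by
  obtain ⟨f, hf0, hfn, hf⟩ := exists_positive_dual_eq_norm (abs_nonneg z)
  have hlim := uawTendsto_iff.1 h |a| (abs_nonneg a) f
  have hbound : ∀ i, ‖z‖ ≤ f (|x i - a| ⊓ |a|) + (g (|z| ⊓ u) + ε) := fun i => by
    -- The part |z| ⊓ |x i| lies in A, where the estimate is known; the rest of |z| is below |x i -
    -- a| ⊓ |a|, on which f tends to 0.
    have hy0 : 0 ≤ |z| ⊓ |x i| := abs_inf_nonneg (abs_nonneg _)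
    have hyA : |z| ⊓ |x i| ∈ A := hA (hxA i) (by rw [abs_of_nonneg hy0]; exact inf_le_right)
    have h1 : |z| - |z| ⊓ |x i| ≤ |x i - a| ⊓ |a| := by
      rw [sub_inf_eq_posPart]
      refine sup_le (le_inf ?_ ?_) (abs_inf_nonneg (abs_nonneg _))
      · refine (sub_le_sub_right hz _).trans ((le_abs_self _).trans ?_)
        rw [abs_sub_comm (x i)]
        exact abs_abs_sub_abs_le _ _
      · exact (sub_le_self _ (abs_nonneg _)).trans hz
    have h2 := StrongDual.mono_of_nonneg hf0 h1
    rw [map_sub, hf, norm_abs_eq_norm] at h2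
    have h3 : f (|z| ⊓ |x i|) ≤ ‖|z| ⊓ |x i|‖ := (le_abs_self _).trans (hfn _)
    have h4 := hgA _ hyA
    rw [abs_of_nonneg hy0] at h4
    have h5 : g (|z| ⊓ |x i| ⊓ u) ≤ g (|z| ⊓ u) :=
      StrongDual.mono_of_nonneg hg (inf_le_inf_right _ inf_le_left)
    linarith
  simpa using ge_of_tendsto' (hlim.add_const (g (|z| ⊓ u) + ε)) hbound

/-- Split |x i - a| ≤ |x i - a| ⊓ |x i| + |x i - a| ⊓ |a|. The first piece lies in A by solidity;
the second is below |a|, where the estimate survives in the limit. The functional is small on both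
by uaw-convergence. -/
theorem DualDominated.tendsto_of_uawTendsto (hd : DualDominated A)
    (hA : LatticeOrderedAddCommGroup.IsSolid A) (hxA : ∀ i, x i ∈ A) (h : UawTendsto l x a) :
    Tendsto x l (𝓝 a) := by
  rcases l.eq_or_neBot with rfl | _
  · exact tendsto_bot
  refine Metric.tendsto_nhds.2 fun ε hε => ?_
  obtain ⟨g, hg0, u, hu0, hg⟩ := hd (ε / 4) (by linarith)
  filter_upwards [(uawTendsto_iff.1 h u hu0 g).eventually
    (gt_mem_nhds (show (0 : ℝ) < ε / 4 by linarith))] with i hi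
  have hb0 : 0 ≤ |x i - a| ⊓ |x i| := abs_inf_nonneg (abs_nonneg _)
  have hc0 : 0 ≤ |x i - a| ⊓ |a| := abs_inf_nonneg (abs_nonneg _)
  have hb := hg (|x i - a| ⊓ |x i|)
    (hA (hxA i) (by rw [abs_of_nonneg hb0]; exact inf_le_right))
  have hc := h.norm_le_of_abs_le hA hxA hg0 hg (z := |x i - a| ⊓ |a|)
    (by rw [abs_of_nonneg hc0]; exact inf_le_right)
  rw [abs_of_nonneg hb0] at hb
  rw [abs_of_nonneg hc0] at hc
  have hb' : g (|x i - a| ⊓ |x i| ⊓ u) ≤ g (|x i - a| ⊓ u) :=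
    StrongDual.mono_of_nonneg hg0 (inf_le_inf_right _ inf_le_left)
  have hc' : g (|x i - a| ⊓ |a| ⊓ u) ≤ g (|x i - a| ⊓ u) :=
    StrongDual.mono_of_nonneg hg0 (inf_le_inf_right _ inf_le_left)
  have hn : ‖x i - a‖ ≤ ‖|x i - a| ⊓ |x i|‖ + ‖|x i - a| ⊓ |a|‖ := by
    rw [← norm_abs_eq_norm (x i - a)]
    exact (norm_le_norm_of_nonneg_of_le (abs_nonneg _) (abs_sub_le_add_inf _ _)).trans
      (norm_add_le _ _)
  rw [dist_eq_norm]
  linarith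

theorem DualDominated.isCompact_of_isUawCompact {B : Set E} (hd : DualDominated A)
    (hA : LatticeOrderedAddCommGroup.IsSolid A) (hBA : B ⊆ A) (hB : IsUawCompact B) :
    IsCompact B := by
  refine IsSeqCompact.isCompact fun x hx => ?_
  obtain ⟨κ, _, _, _, φ, hφ, a, ha, hlim⟩ := hB (ULift.{u} ℕ) (fun n => x n.down) fun n => hx _
  exact ⟨a, ha, exists_subseq_of_subnet hφ
    (hd.tendsto_of_uawTendsto hA (fun k => hBA (hx _)) hlim)⟩

theorem DualDominated.isCompact_closure_of_isRelativelyUawCompact {B : Set E}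
    (hd : DualDominated A) (hA : LatticeOrderedAddCommGroup.IsSolid A) (hBA : B ⊆ A)
    (hB : IsRelativelyUawCompact B) : IsCompact (closure B) := by
  refine isCompact_closure_of_forall_seq fun x hx => ?_
  obtain ⟨κ, _, _, _, φ, hφ, a, hlim⟩ := hB (ULift.{u} ℕ) (fun n => x n.down) fun n => hx _
  exact ⟨a, exists_subseq_of_subnet hφ
    (hd.tendsto_of_uawTendsto hA (fun k => hBA (hx _)) hlim)⟩

omit [IsOrderedModule ℝ E] in
/-- Disjoint sequences in a solid set `A` are null as soon as the bounded uaw-compact subsets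
of `A` are relatively norm compact. -/
theorem disjointNull_of_forall_isCompact_closure
    (hA : LatticeOrderedAddCommGroup.IsSolid A) (hAb : Bornology.IsBounded A)
    (h : ∀ B ⊆ A, Bornology.IsBounded B → IsUawCompact B → IsCompact (closure B)) :
    DisjointNull A := by
  intro x hx hdisj
  by_contra hcon
  obtain ⟨ε, hε, hfreq⟩ : ∃ ε > 0, ∃ᶠ n in atTop, ε ≤ ‖x n‖ := by
    by_contra! hc
    refine hcon (Metric.tendsto_nhds.2 fun ε hε => ?_)
    filter_upwards [hc ε hε] with n hn
    simpa using hn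
  obtain ⟨φ, hφ, hφε⟩ := extraction_of_frequently_atTop hfreq
  have hydisj : ∀ m n, m ≠ n → |(x ∘ φ) m| ⊓ |(x ∘ φ) n| = 0 := fun m n hmn =>
    hdisj _ _ (hφ.injective.ne hmn)
  have hsub : insert 0 (Set.range (x ∘ φ)) ⊆ A := by
    refine Set.insert_subset (hA (hx 0) (by simp)) ?_
    rintro _ ⟨n, rfl⟩
    exact hx _
  obtain ⟨a, -, ψ, hψ, ha⟩ := (h _ hsub (hAb.subset hsub) (isUawCompact_insert_range
    (uawTendsto_zero_of_pairwise_disjoint hydisj))).tendsto_subseq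
    (x := x ∘ φ) fun n => subset_closure (Set.mem_insert_of_mem _ (Set.mem_range_self n))
  have habs : Tendsto (fun n => |(x ∘ φ) (ψ n)|) atTop (𝓝 |a|) :=
    (continuous_id.sup continuous_neg).tendsto a |>.comp ha
  -- Letting one index run makes the limit a disjoint from every term; letting the other run makes
  -- it disjoint from itself.
  have h1 : ∀ n, |(x ∘ φ) (ψ n)| ⊓ |a| = 0 := fun n => by
    refine tendsto_nhds_unique (tendsto_const_nhds.inf_nhds habs)
      (tendsto_const_nhds.congr' ?_)
    filter_upwards [eventually_gt_atTop n] with m hm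
    exact (hydisj _ _ (hψ.injective.ne hm.ne)).symm
  have h2 : |a| ⊓ |a| = 0 :=
    tendsto_nhds_unique (habs.inf_nhds tendsto_const_nhds) (by simp only [h1, tendsto_const_nhds])
  have h3 : ε ≤ ‖a‖ := ge_of_tendsto' ha.norm fun n => hφε _
  rw [inf_idem] at h2
  rw [← norm_abs_eq_norm, h2, norm_zero] at h3
  linarith

omit [NormedSpace ℝ E] [IsOrderedAddMonoid E] [IsOrderedModule ℝ E] in
theorem isBounded_solidClosure {S : Set E} (hS : Bornology.IsBounded S) :
    Bornology.IsBounded (LatticeOrderedAddCommGroup.solidClosure S) := by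
  obtain ⟨K, hK⟩ := hS.exists_norm_le
  refine isBounded_iff_forall_norm_le.2 ⟨K, fun x ⟨y, hy, hxy⟩ => ?_⟩
  exact (norm_le_norm_of_abs_le_abs hxy).trans (hK y hy)

end DualDominated

/-! ### The equivalences. -/

theorem corollary3p11 {E : Type u} [NormedAddCommGroup E] [NormedSpace ℝ E] [CompleteSpace E]
    [Lattice E] [IsOrderedAddMonoid E] [IsOrderedModule ℝ E] [HasSolidNorm E]
    (S : Set E) (hS : Bornology.IsBounded S) :
    List.TFAE [
      IsLWeaklyCompact S,
      ∀ ε : ℝ, 0 < ε → ∃ g : StrongDual ℝ E, (∀ x : E, 0 ≤ x → 0 ≤ g x) ∧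
        ∃ u : E, 0 ≤ u ∧
          ∀ x ∈ LatticeOrderedAddCommGroup.solidClosure S, ‖x‖ ≤ g (|x| ⊓ u) + ε,
      ∀ (ι : Type v) [Preorder ι] [IsDirectedOrder ι] [Nonempty ι] (x : ι → E),
        (∀ i, x i ∈ LatticeOrderedAddCommGroup.solidClosure S) →
          UawTendsto atTop x 0 → Tendsto x atTop (𝓝 0),
      ∀ A : Set E, A ⊆ LatticeOrderedAddCommGroup.solidClosure S →
        Bornology.IsBounded A → IsUawCompact A → IsCompact A,
      ∀ A : Set E, A ⊆ LatticeOrderedAddCommGroup.solidClosure S →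
        Bornology.IsBounded A → IsRelativelyUawCompact A → IsCompact (closure A)] := by
  have hsol := LatticeOrderedAddCommGroup.isSolid_solidClosure S
  have hb := isBounded_solidClosure hS
  tfae_have 1 → 2 := fun h => DisjointNull.dualDominated h.2 hsol hb
  tfae_have 2 → 3 := fun h ι _ _ _ x hx hlim =>
    DualDominated.tendsto_of_uawTendsto h hsol hx hlim
  tfae_have 3 → 1 := by
    refine fun h => ⟨hS, fun x hx hdisj => ?_⟩
    -- The nets in (3) have index sets in `Type v`, so the sequence is reindexed by a lifted copy of
    -- ℕ.
    have hdown : Tendsto (ULift.down : ULift.{v} ℕ → ℕ) atTop atTop :=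
      tendsto_atTop.2 fun b => (eventually_ge_atTop (ULift.up b)).mono fun i hi => hi
    have hup : Tendsto (ULift.up : ℕ → ULift.{v} ℕ) atTop atTop :=
      tendsto_atTop.2 fun b => (eventually_ge_atTop b.down).mono fun i hi => hi
    have hlim := h (ULift.{v} ℕ) (x ∘ ULift.down) (fun i => hx _)
      ((uawTendsto_zero_of_pairwise_disjoint hdisj).comp hdown)
    simpa using (hlim.comp hup).norm
  tfae_have 2 → 5 := fun h A hA _ hAc =>
    DualDominated.isCompact_closure_of_isRelativelyUawCompact h hsol hA hAc
  tfae_have 2 → 4 := fun h A hA _ hAc => DualDominated.isCompact_of_isUawCompact h hsol hA hAc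
  tfae_have 4 → 1 := fun h => ⟨hS, disjointNull_of_forall_isCompact_closure hsol hb
    fun B hB hBb hBc => (h B hB hBb hBc).closure⟩
  tfae_have 5 → 1 := fun h => ⟨hS, disjointNull_of_forall_isCompact_closure hsol hb
    fun B hB hBb hBc => h B hB hBb hBc.isRelativelyUawCompact⟩
  tfae_finish
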